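/- Let $(X,d)$ be a metric space with a Borel regular outer measure $\mu$ such that every ball $B(x,r)=\{y: d(y,x)<r\}$, $r>0$, has positive and finite measure and $\mu(B(x,2r))\le c_d\,\mu(B(x,r))$ for all $x\in X$, $r>0$, with a fixed constant $c_d$. **Capacity.** Let $0<s<\infty$, $0<p<\infty$, $0<q\le\infty$. For a measurable, a.e. finite $u:X\to[-\infty,\infty]$, let $\mathbb D^s(u)$ be the set of sequences $(g_k)_{k\in\mathbb Z}$ of nonnegative measurable functions for which there is a set $N$ with $\mu(N)=0$ and $|u(x)-u(y)|\le d(x,y)^s(g_k(x)+g_k(y))$ for all $k\in\mathbb Z$ and all $x,y\in X\setminus N$ with $2^{-k-1}\le d(x,y)<2^{-k}$. Put $$\|u\|_{N^s_{p,q}(X)}=\|u\|_{L^p(X)}+\inf_{(g_k)\in\mathbb D^s(u)}\Big\|\big(\|g_k\|_{L^p(X)}\big)_{k\in\mathbb Z}\Big\|_{\ell^q},$$ let $N^s_{p,q}(X)$ be the set of those $u$ for which this is finite, and $$C^s_{p,q}(E)=\inf\big\{\|u\|_{N^s_{p,q}(X)}^p:\ u\in N^s_{p,q}(X),\ u\ge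 1\text{ in a neighbourhood of }E\big\}.$$ **Cocontent.** Let $\phi:(0,\infty)\to(0,\infty)$ be increasing (that is, nondecreasing), $0<\theta\le\infty$ and $0<R<\infty$. For $E\subset X$ let $$\mathcal H^{\phi,\theta}_R(E)=\inf\Big[\sum_{i\in\mathbb Z:\,2^{-i}\le R}\Big(\sum_{j\in I_i}\frac{\mu(B(x_j,r_j))}{\phi(r_j)}\Big)^{\theta}\Big]^{1/\theta},\qquad I_i=\{j:2^{-i}\le r_j<2^{-i+1}\},$$ where the infimum is over all finite or countable coverings $\{B(x_j,r_j)\}$ of $E$ with $0<r_j\le R$; when $\theta=\infty$, the expression $[\sum_i(\cdot)^\theta]^{1/\theta}$ means the supremum over $i$. **Theorem.** Let $0<s<1$, $0<p<\infty$, $0<q\le\infty$, and let $\phi:(0,\infty)\to(0,\infty)$ be an increasing function such that $$\int_0^a\phi(t)^{-1/p}\,t^{s-1}\,dt<\infty\qquad\text{for every }0<a<\infty.$$ Let $x_0\in X$, $0<R<\infty$, and assume that $B(x_0,8R)\setminus B(x_0,4R)$ is nonempty. Then there are constants $C>0$ and $c>0$ such that $$\mathcal H^{\phi,q/p}_{cR}(E)\le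 C\,C^s_{p,q}(E)$$ for every compact set $E\subset B(x_0,R)$, where $q/p=\infty$ if $q=\infty$. -/

import Mathlib

open MeasureTheory Set
open scoped ENNReal NNReal

noncomputable section

namespace BesovCap

variable {X : Type*} [MetricSpace X] [MeasurableSpace X]

/-- `μ` is a doubling measure for which every ball has positive and finite measure. (In a Borel
space, a `Measure`, evaluated on arbitrary sets, is a Borel regular outer measure.) -/
def IsDoublingMeasure (μ : Measure X) : Prop :=
  (∀ (x : X) (r : ℝ), 0 < r → 0 < μ (Metric.ball x r) ∧ μ (Metric.ball x r) < ∞) ∧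
  ∃ cd : ℝ≥0, ∀ (x : X) (r : ℝ), 0 < r → μ (Metric.ball x (2 * r)) ≤ cd * μ (Metric.ball x r)

/-- `L⁰(X)`: measurable, almost everywhere finite functions with values in `[-∞, ∞]`.
Measurability with respect to the outer measure (that is, the completed measure)
is `AEMeasurable`. -/
def MemL0 (μ : Measure X) (u : X → EReal) : Prop :=
  AEMeasurable u μ ∧ ∀ᵐ x ∂μ, u x ≠ ⊤ ∧ u x ≠ ⊥

/-- `(g_k)` is a fractional `s`-gradient of `u`. The value of `u x - u y` for infinite `u x`, `u y`
is immaterial, because such points can be put into the exceptional set `N`. -/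
def IsFracGradient (μ : Measure X) (s : ℝ) (u : X → EReal) (g : ℤ → X → ℝ≥0∞) : Prop :=
  (∀ k, AEMeasurable (g k) μ) ∧
  ∃ N : Set X, μ N = 0 ∧ ∀ (k : ℤ) (x y : X), x ∉ N → y ∉ N →
    (2 : ℝ) ^ (-k - 1) ≤ dist x y → dist x y < (2 : ℝ) ^ (-k) →
      (u x - u y).abs ≤ ENNReal.ofReal (dist x y ^ s) * (g k x + g k y)

/-- The `ℓ^q(ℤ)` (quasi)norm of a nonnegative sequence, `0 < q ≤ ∞`. -/
def lqNorm (q : ℝ≥0∞) (a : ℤ → ℝ≥0∞) : ℝ≥0∞ :=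
  if q = ∞ then ⨆ k, a k else (∑' k, a k ^ q.toReal) ^ (1 / q.toReal)

/-- The mixed `ℓ^q(L^p(X))` (quasi)norm, `0 < p < ∞`, `0 < q ≤ ∞`. -/
def lqLpNorm (μ : Measure X) (p : ℝ) (q : ℝ≥0∞) (g : ℤ → X → ℝ≥0∞) : ℝ≥0∞ :=
  lqNorm q fun k => eLpNorm (g k) (ENNReal.ofReal p) μ

/-- The homogeneous Hajłasz–Besov (quasi)seminorm. -/
def homBesovNorm (μ : Measure X) (s p : ℝ) (q : ℝ≥0∞) (u : X → EReal) : ℝ≥0∞ :=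
  ⨅ (g : ℤ → X → ℝ≥0∞) (_ : IsFracGradient μ s u g), lqLpNorm μ p q g

/-- The `L^p` (quasi)norm of an extended real-valued function. -/
def extLpNorm (μ : Measure X) (p : ℝ) (u : X → EReal) : ℝ≥0∞ :=
  eLpNorm (fun x => (u x).abs) (ENNReal.ofReal p) μ

/-- The Hajłasz–Besov (quasi)norm. -/
def besovNorm (μ : Measure X) (s p : ℝ) (q : ℝ≥0∞) (u : X → EReal) : ℝ≥0∞ :=
  extLpNorm μ p u + homBesovNorm μ s p q u

/-- Membership in the Hajłasz–Besov space `N^s_{p,q}(X)`. -/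
def MemBesov (μ : Measure X) (s p : ℝ) (q : ℝ≥0∞) (u : X → EReal) : Prop :=
  MemL0 μ u ∧ extLpNorm μ p u < ∞ ∧ homBesovNorm μ s p q u < ∞

/-- `u` is an admissible function for the capacity of `E`. -/
def IsAdmissible (μ : Measure X) (s p : ℝ) (q : ℝ≥0∞) (E : Set X) (u : X → EReal) : Prop :=
  MemBesov μ s p q u ∧ ∃ U : Set X, IsOpen U ∧ E ⊆ U ∧ ∀ x ∈ U, 1 ≤ u x

/-- The Besov capacity `C^s_{p,q}(E)`, `0 < p < ∞`. -/
def besovCapacity (μ : Measure X) (s p : ℝ) (q : ℝ≥0∞) (E : Set X) : ℝ≥0∞ :=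
  ⨅ (u : X → EReal) (_ : IsAdmissible μ s p q E u), besovNorm μ s p q u ^ p

/-- The Netrusov–Hausdorff cocontent `H^{φ,θ}_R(E)`, `0 < θ ≤ ∞`, `0 < R < ∞`. The infimum is over
all finite or countable coverings of `E` by balls `B(x_j, r_j)`, `j ∈ J`, with `0 < r_j ≤ R`.
The sum over `i` runs over all of `ℤ`; only the `i` with `2^{-i} ≤ R` contribute,
since `I_i = {j ∈ J : 2^{-i} ≤ r_j < 2^{-i+1}}` is empty otherwise. -/
def cocontent (μ : Measure X) (φ : ℝ → ℝ) (θ : ℝ≥0∞) (R : ℝ) (E : Set X) : ℝ≥0∞ :=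
  ⨅ (J : Set ℕ) (x : ℕ → X) (r : ℕ → ℝ)
    (_ : (∀ j ∈ J, 0 < r j ∧ r j ≤ R) ∧ E ⊆ ⋃ j ∈ J, Metric.ball (x j) (r j)),
    lqNorm θ fun i : ℤ =>
      ∑' j : {j : ℕ // j ∈ J ∧ (2 : ℝ) ^ (-i) ≤ r j ∧ r j < (2 : ℝ) ^ (-i + 1)},
        μ (Metric.ball (x j) (r j)) / ENNReal.ofReal (φ (r j))

end BesovCap

end

noncomputable section

namespace BesovCap

variable {X : Type*}

/-! Let `u` be admissible for `E`. If its `L^p` norm is not small, the single ball `B(x₀, R)`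
already gives the estimate. Otherwise `|u| < 1/2` on most of a fixed large ball about each `x ∈ E`,
while `u ≥ 1` near `x`, so `u` must rise by more than `1/2` along a chain of points converging to
`x`.

The rise below scale `2^{-i}` is controlled by `F_i ^ (1/p)`, where `F_i = ∑ₘ 2^{-spm} g_{i+m}^p`
(`tailGradient`). If at every scale the integral of `F_i` were at most `ε / φ(2^{-i})` times the
measure of a slightly smaller ball, the integral condition on `φ` would make the total rise at most
`1/2` (`exists_eps`). Hence at some scale the integral is larger (`exists_level_lt_lintegral`).

The points with the same bad scale are covered by balls of that radius, whose `μ/φ`-sum is at most a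
constant times `∫ F_i` (`exists_ball_cover`). Since `∫ F_i` is a geometric convolution of
`‖g_k‖_p^p`, its `ℓ^{q/p}` norm is bounded by that of `‖g_k‖_p^p` (`lqNorm_geometric_le`), which is
the `p`-th power of the gradient norm. Working with `p`-th powers and chosen points, rather than
means of `u`, treats all `p, q > 0` alike. -/

/-! ### Sequence norms -/

lemma lqNorm_mono {q : ℝ≥0∞} {a b : ℤ → ℝ≥0∞} (h : ∀ k, a k ≤ b k) : lqNorm q a ≤ lqNorm q b := by
  unfold lqNorm
  split_ifs with hq
  · exact iSup_mono h
  · exact ENNReal.rpow_le_rpow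
      (ENNReal.tsum_le_tsum fun k => ENNReal.rpow_le_rpow (h k) ENNReal.toReal_nonneg) (by positivity)

lemma lqNorm_const_mul {q : ℝ≥0∞} (hq : 0 < q) (c : ℝ≥0∞) (a : ℤ → ℝ≥0∞) :
    lqNorm q (fun k => c * a k) = c * lqNorm q a := by
  unfold lqNorm
  split_ifs with hq'
  · exact (ENNReal.mul_iSup _ _).symm
  · have hpos : 0 < q.toReal := ENNReal.toReal_pos hq.ne' hq'
    simp_rw [ENNReal.mul_rpow_of_nonneg _ _ hpos.le, ENNReal.tsum_mul_left]
    rw [ENNReal.mul_rpow_of_nonneg _ _ (by positivity), ← ENNReal.rpow_mul,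
      mul_one_div_cancel hpos.ne', ENNReal.rpow_one]

lemma lqNorm_single {q : ℝ≥0∞} (hq : 0 < q) (i : ℤ) (c : ℝ≥0∞) :
    lqNorm q (fun k => if k = i then c else 0) ≤ c := by
  unfold lqNorm
  split_ifs with hq'
  · refine iSup_le fun k => ?_
    dsimp only
    split_ifs <;> simp
  · have hpos : 0 < q.toReal := ENNReal.toReal_pos hq.ne' hq'
    have : ∀ k : ℤ, (if k = i then c else 0) ^ q.toReal = if k = i then c ^ q.toReal else 0 := by
      intro k
      split_ifs <;> simp [hpos]
    simp_rw [this]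
    rw [tsum_ite_eq, ← ENNReal.rpow_mul, mul_one_div_cancel hpos.ne', ENNReal.rpow_one]

/-- This is where the cocontent exponent `q / p` comes from: the levels of the cocontent are
compared with `p`-th powers of `L^p` norms. -/
lemma lqNorm_rpow {p : ℝ} (hp : 0 < p) {q : ℝ≥0∞} (hq : 0 < q) (a : ℤ → ℝ≥0∞) :
    lqNorm (q / ENNReal.ofReal p) (fun k => a k ^ p) = lqNorm q a ^ p := by
  unfold lqNorm
  by_cases hq' : q = ∞
  · subst hq'
    rw [ENNReal.top_div_of_ne_top ENNReal.ofReal_ne_top, if_pos rfl, if_pos rfl]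
    exact ((ENNReal.orderIsoRpow p hp).map_iSup a).symm
  · have hne : q / ENNReal.ofReal p ≠ ∞ :=
      ENNReal.div_ne_top hq' (by simpa using hp)
    have hpos : 0 < q.toReal := ENNReal.toReal_pos hq.ne' hq'
    rw [if_neg hne, if_neg hq', ENNReal.toReal_div, ENNReal.toReal_ofReal hp.le]
    simp_rw [← ENNReal.rpow_mul]
    congr 1
    · congr 1
      funext k
      congr 1
      field_simp
    · field_simp

/-- Convolution with a one-sided geometric sequence is bounded on `ℓ^q` for all `0 < q ≤ ∞`. -/
lemma lqNorm_geometric_le {q : ℝ≥0∞} (hq : 0 < q) {ρ : ℝ≥0∞} (hρ : ρ < 1) :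
    ∃ K : ℝ≥0∞, K ≠ ∞ ∧ ∀ a : ℤ → ℝ≥0∞,
      lqNorm q (fun i => ∑' m : ℕ, ρ ^ m * a (i + m)) ≤ K * lqNorm q a := by
  have hgeom : ∀ τ : ℝ≥0∞, τ < 1 → (∑' m : ℕ, τ ^ m) ≠ ∞ := by
    intro τ hτ
    rw [ENNReal.tsum_geometric]
    simpa [tsub_eq_zero_iff_le] using hτ
  by_cases hq' : q = ∞
  · refine ⟨∑' m : ℕ, ρ ^ m, hgeom ρ hρ, fun a => ?_⟩
    simp only [lqNorm, hq', if_true]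
    refine iSup_le fun i => ?_
    rw [← ENNReal.tsum_mul_right]
    exact ENNReal.tsum_le_tsum fun m => mul_le_mul_right (le_iSup a _) _
  have hpos : 0 < q.toReal := ENNReal.toReal_pos hq.ne' hq'
  set t := q.toReal
  -- Half of the decay sums a geometric series; the other half bounds the remaining supremum by an
  -- `ℓ^t` sum. This needs no distinction between `t ≥ 1` and `t < 1`.
  obtain ⟨σ, hσ1, hσσ⟩ : ∃ σ : ℝ≥0∞, σ < 1 ∧ σ * σ = ρ := by
    refine ⟨ρ ^ (1 / 2 : ℝ), ENNReal.rpow_lt_one hρ (by norm_num), ?_⟩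
    rw [← ENNReal.rpow_add_of_nonneg _ _ (by norm_num) (by norm_num)]
    norm_num
  refine ⟨(∑' m : ℕ, σ ^ m) * (∑' m : ℕ, (σ ^ t) ^ m) ^ (1 / t),
    ENNReal.mul_ne_top (hgeom σ hσ1)
      (ENNReal.rpow_ne_top_of_nonneg (by positivity) (hgeom _ (ENNReal.rpow_lt_one hσ1 hpos))),
    fun a => ?_⟩
  have h1 : ∀ i : ℤ, (∑' m : ℕ, ρ ^ m * a (i + m)) ≤
      (∑' m : ℕ, σ ^ m) * (∑' m : ℕ, (σ ^ m * a (i + m)) ^ t) ^ (1 / t) := by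
    intro i
    rw [← ENNReal.tsum_mul_right]
    refine ENNReal.tsum_le_tsum fun m => ?_
    rw [← hσσ, mul_pow, mul_assoc]
    refine mul_le_mul_right ?_ _
    rw [← ENNReal.rpow_le_rpow_iff hpos, ← ENNReal.rpow_mul, one_div_mul_cancel hpos.ne',
      ENNReal.rpow_one]
    exact ENNReal.le_tsum (f := fun m : ℕ => (σ ^ m * a (i + m)) ^ t) m
  refine (lqNorm_mono h1).trans ?_
  rw [lqNorm_const_mul hq, mul_assoc]
  refine mul_le_mul_right ?_ _
  simp only [lqNorm, hq', if_false]
  rw [← ENNReal.mul_rpow_of_nonneg _ _ (by positivity)]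
  refine ENNReal.rpow_le_rpow ?_ (by positivity)
  simp_rw [← ENNReal.rpow_mul]
  change (∑' i : ℤ, (∑' m : ℕ, (σ ^ m * a (i + m)) ^ t) ^ (1 / t * t)) ≤ _
  simp_rw [one_div_mul_cancel hpos.ne', ENNReal.rpow_one]
  rw [ENNReal.tsum_comm, ← ENNReal.tsum_mul_right]
  refine ENNReal.tsum_le_tsum fun m => ?_
  simp_rw [ENNReal.mul_rpow_of_nonneg _ _ hpos.le]
  rw [ENNReal.tsum_mul_left, ← ENNReal.rpow_natCast, ← ENNReal.rpow_natCast, ← ENNReal.rpow_mul,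
    ← ENNReal.rpow_mul, mul_comm t]
  refine mul_le_mul_right (le_of_eq ?_) _
  exact (Equiv.addRight (m : ℤ)).tsum_eq (fun i => a i ^ t)

/-! ### Upper bounds for the cocontent -/

/-- Coverings indexed by an arbitrary countable type may be used to estimate the cocontent. -/
lemma cocontent_le_of_countable [MetricSpace X] [MeasurableSpace X] (μ : Measure X) (φ : ℝ → ℝ)
    (θ : ℝ≥0∞) (R : ℝ) (E : Set X)
    {ι : Type*} [Countable ι] [Nonempty X] (x : ι → X) (r : ι → ℝ)
    (hr : ∀ a, 0 < r a ∧ r a ≤ R) (hE : E ⊆ ⋃ a, Metric.ball (x a) (r a)) :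
    cocontent μ φ θ R E ≤ lqNorm θ fun i : ℤ =>
      ∑' a : {a : ι // (2 : ℝ) ^ (-i) ≤ r a ∧ r a < (2 : ℝ) ^ (-i + 1)},
        μ (Metric.ball (x a) (r a)) / ENNReal.ofReal (φ (r a)) := by
  classical
  obtain ⟨e, he⟩ := exists_injective_nat ι
  let x' : ℕ → X := Function.extend e x fun _ => Classical.arbitrary X
  let r' : ℕ → ℝ := Function.extend e r 0
  have hx' : ∀ a, x' (e a) = x a := fun a => he.extend_apply _ _ _
  have hr' : ∀ a, r' (e a) = r a := fun a => he.extend_apply _ _ _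
  unfold cocontent
  refine iInf_le_of_le (range e) <| iInf_le_of_le x' <| iInf_le_of_le r' <| iInf_le_of_le
    ⟨?_, ?_⟩ ?_
  · rintro _ ⟨a, rfl⟩
    rw [hr']
    exact hr a
  · simp only [biUnion_range, hx', hr']
    exact hE
  · refine lqNorm_mono fun i => ?_
    choose f hf using fun j : {j : ℕ // j ∈ range e ∧ (2 : ℝ) ^ (-i) ≤ r' j ∧
      r' j < (2 : ℝ) ^ (-i + 1)} => j.2.1
    let F : {j : ℕ // j ∈ range e ∧ (2 : ℝ) ^ (-i) ≤ r' j ∧ r' j < (2 : ℝ) ^ (-i + 1)} →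
        {a : ι // (2 : ℝ) ^ (-i) ≤ r a ∧ r a < (2 : ℝ) ^ (-i + 1)} :=
      fun j => ⟨f j, by have := j.2.2; rwa [← hf j, hr'] at this⟩
    have hF : Function.Injective F := by
      intro j j' h
      have h' : f j = f j' := congrArg Subtype.val h
      exact Subtype.ext (by rw [← hf j, ← hf j', h'])
    refine le_trans (le_of_eq ?_) (ENNReal.tsum_comp_le_tsum_of_injective hF _)
    refine tsum_congr fun j => ?_
    rw [← hf j, hx', hr']

/-- A radius lies in exactly one dyadic class, so the sequence has one nonzero entry and the
exponent plays no role. -/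
lemma cocontent_le_single [MetricSpace X] [MeasurableSpace X] (μ : Measure X) (φ : ℝ → ℝ)
    {θ : ℝ≥0∞} (hθ : 0 < θ) {R r : ℝ}
    {E : Set X} {x₀ : X} (hr : 0 < r) (hrR : r ≤ R) (hE : E ⊆ Metric.ball x₀ r) :
    cocontent μ φ θ R E ≤ μ (Metric.ball x₀ r) / ENNReal.ofReal (φ r) := by
  have : Nonempty X := ⟨x₀⟩
  refine (cocontent_le_of_countable μ φ θ R E (ι := Unit) (fun _ => x₀) (fun _ => r)
    (fun _ => ⟨hr, hrR⟩) (hE.trans (subset_iUnion_of_subset () subset_rfl))).trans ?_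
  obtain ⟨n, hn1, hn2⟩ := exists_mem_Ico_zpow hr (one_lt_two (α := ℝ))
  refine le_trans (lqNorm_mono fun i => ?_) (lqNorm_single hθ (-n) _)
  split_ifs with hi
  · rw [tsum_fintype]
    refine (Finset.sum_le_card_nsmul _ _ _ fun _ _ => le_rfl).trans ?_
    rw [nsmul_eq_mul]
    refine mul_le_of_le_one_left' ?_
    have : Fintype.card {a : Unit // (2 : ℝ) ^ (-i) ≤ r ∧ r < (2 : ℝ) ^ (-i + 1)} ≤ 1 :=
      (Fintype.card_subtype_le _).trans (by simp)
    exact_mod_cast this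
  · refine le_of_eq (ENNReal.tsum_eq_zero.2 fun a => absurd a.2 ?_)
    rintro ⟨h1, h2⟩
    have h3 := (zpow_lt_zpow_iff_right₀ (one_lt_two (α := ℝ))).1 (h1.trans_lt hn2)
    have h4 := (zpow_lt_zpow_iff_right₀ (one_lt_two (α := ℝ))).1 (hn1.trans_lt h2)
    omega

/-! ### The integral condition in dyadic form -/

lemma tsum_lintegral_dyadic_le (f : ℝ → ℝ≥0∞) (i₀ : ℤ) :
    ∑' n : ℕ, ∫⁻ t in Ioo ((2 : ℝ) ^ (-(i₀ + n) - 1)) ((2 : ℝ) ^ (-(i₀ + n))), f t ≤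
      ∫⁻ t in Ioo 0 ((2 : ℝ) ^ (-i₀)), f t := by
  rw [← lintegral_iUnion (fun _ => measurableSet_Ioo)]
  · refine lintegral_mono_set (iUnion_subset fun n t ht => ⟨?_, ?_⟩)
    · exact (zpow_pos two_pos _).trans ht.1
    · exact ht.2.trans_le (zpow_le_zpow_right₀ one_le_two (by omega))
  · intro m n hmn
    refine Set.disjoint_left.2 fun t ht ht' => hmn ?_
    have h1 := (zpow_lt_zpow_iff_right₀ (one_lt_two (α := ℝ))).1 (ht.1.trans ht'.2)
    have h2 := (zpow_lt_zpow_iff_right₀ (one_lt_two (α := ℝ))).1 (ht'.1.trans ht.2)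
    omega

/-- Since `φ` is nondecreasing and `s < 1`, the integrand on `(d/2, d)` is at least its value at
`d`; times the length `d/2` this is half of the term `d^s φ(d)^{-1/p}`. -/
lemma tsum_dyadic_ne_top {s p : ℝ} (hs1 : s < 1) (hp : 0 < p) {φ : ℝ → ℝ}
    (hφpos : ∀ t, 0 < t → 0 < φ t) (hφmono : MonotoneOn φ (Set.Ioi 0))
    (hφint : ∀ a : ℝ, 0 < a →
      IntegrableOn (fun t : ℝ => φ t ^ (-(1 / p)) * t ^ (s - 1)) (Set.Ioo 0 a) volume)
    (i₀ : ℤ) :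
    ∑' n : ℕ, (2 : ℝ≥0∞) ^ (-((i₀ + n : ℤ) : ℝ) * s) *
      ENNReal.ofReal (φ (2 ^ (-(i₀ + n)))) ^ (-(1 / p)) ≠ ∞ := by
  have hfin := (hφint (2 ^ (-i₀)) (zpow_pos two_pos _)).lintegral_lt_top
  have hle := tsum_lintegral_dyadic_le
    (fun t => ENNReal.ofReal (φ t ^ (-(1 / p)) * t ^ (s - 1))) i₀
  have hterm : ∀ n : ℕ, 2⁻¹ * ((2 : ℝ≥0∞) ^ (-((i₀ + n : ℤ) : ℝ) * s) *
      ENNReal.ofReal (φ (2 ^ (-(i₀ + n)))) ^ (-(1 / p))) ≤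
      ∫⁻ t in Ioo ((2 : ℝ) ^ (-(i₀ + n) - 1)) ((2 : ℝ) ^ (-(i₀ + n))),
        ENNReal.ofReal (φ t ^ (-(1 / p)) * t ^ (s - 1)) := by
    intro n
    generalize hj : i₀ + (n : ℤ) = j
    have hd : (0 : ℝ) < 2 ^ (-j) := zpow_pos two_pos _
    have hd' : (2 : ℝ) ^ (-j - 1) = 2 ^ (-j) / 2 := by
      rw [zpow_sub_one₀ two_ne_zero, div_eq_mul_inv]
    set d : ℝ := 2 ^ (-j) with hd_def
    have hdr : d = (2 : ℝ) ^ (-(j : ℝ)) := by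
      rw [hd_def, ← Real.rpow_intCast]
      push_cast
      rfl
    calc _ = ENNReal.ofReal (φ d ^ (-(1 / p)) * d ^ (s - 1)) *
          volume (Ioo (2 ^ (-j - 1)) d) := by
          rw [Real.volume_Ioo, hd', ← ENNReal.ofReal_mul (by have := hφpos d hd; positivity),
            ENNReal.ofReal_rpow_of_pos (hφpos d hd),
            show (2 : ℝ≥0∞) = ENNReal.ofReal 2 by simp,
            ENNReal.ofReal_rpow_of_pos two_pos, ← ENNReal.ofReal_inv_of_pos two_pos,
            ← ENNReal.ofReal_mul (by positivity), ← ENNReal.ofReal_mul (by positivity)]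
          congr 1
          rw [show d - d / 2 = 2⁻¹ * d by ring, Real.rpow_mul two_pos.le, ← hdr,
            Real.rpow_sub_one hd.ne']
          field_simp
      _ = ∫⁻ _ in Ioo ((2 : ℝ) ^ (-j - 1)) d,
          ENNReal.ofReal (φ d ^ (-(1 / p)) * d ^ (s - 1)) := by rw [setLIntegral_const]
      _ ≤ _ := by
          refine setLIntegral_mono' measurableSet_Ioo fun t ht => ENNReal.ofReal_le_ofReal ?_
          have ht0 : 0 < t := (zpow_pos two_pos _).trans ht.1
          refine mul_le_mul ?_ ?_ (by positivity) (by have := hφpos t ht0; positivity)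
          · exact Real.rpow_le_rpow_of_nonpos (hφpos t ht0) (hφmono ht0 hd ht.2.le)
              (by simp [hp.le])
          · exact Real.rpow_le_rpow_of_nonpos ht0 ht.2.le (by linarith)
  have h2 := (ENNReal.tsum_le_tsum hterm).trans hle
  rw [ENNReal.tsum_mul_left] at h2
  intro htop
  rw [htop, ENNReal.mul_top (by simp)] at h2
  exact absurd hfin (not_lt.2 h2)

/-- A small multiple of `φ⁻¹` makes the oscillation along a dyadic chain at most `1 / 2`. -/
lemma exists_eps {s p : ℝ} (hs1 : s < 1) (hp : 0 < p) {φ : ℝ → ℝ}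
    (hφpos : ∀ t, 0 < t → 0 < φ t) (hφmono : MonotoneOn φ (Set.Ioi 0))
    (hφint : ∀ a : ℝ, 0 < a →
      IntegrableOn (fun t : ℝ => φ t ^ (-(1 / p)) * t ^ (s - 1)) (Set.Ioo 0 a) volume)
    (i₀ : ℤ) :
    ∃ ε : ℝ≥0∞, ε ≠ 0 ∧ ε ≠ ∞ ∧
    ∑' n : ℕ, (2 : ℝ≥0∞) ^ (-((i₀ + n : ℤ) : ℝ) * s) *
      (2 * (4 * (ε / ENNReal.ofReal (φ (2 ^ (-(i₀ + n)))))) ^ (1 / p)) ≤ 2⁻¹ := by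
  have hS := tsum_dyadic_ne_top hs1 hp hφpos hφmono hφint i₀
  set S := ∑' n : ℕ, (2 : ℝ≥0∞) ^ (-((i₀ + n : ℤ) : ℝ) * s) *
      ENNReal.ofReal (φ (2 ^ (-(i₀ + n)))) ^ (-(1 / p)) with hS_def
  -- With `ε = η^p / 4` one has `(4ε)^{1/p} = η`, so the sum becomes `2ηS ≤ 1/2`. The `+ 1` keeps
  -- `η` finite if `S = 0`.
  have hη0 : (4 * (S + 1))⁻¹ ≠ 0 := ENNReal.inv_ne_zero.2 (ENNReal.mul_ne_top (by simp) (by simpa))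
  have hηt : (4 * (S + 1))⁻¹ ≠ ∞ := ENNReal.inv_ne_top.2 (by simp)
  set η : ℝ≥0∞ := (4 * (S + 1))⁻¹ with hη
  have hε0 : η ^ p / 4 ≠ 0 := ENNReal.div_ne_zero.2
    ⟨(ENNReal.rpow_pos (pos_iff_ne_zero.2 hη0) hηt).ne', by simp⟩
  refine ⟨η ^ p / 4, hε0,
    ENNReal.div_ne_top (ENNReal.rpow_ne_top_of_nonneg hp.le hηt) (by simp), ?_⟩
  have hterm : ∀ n : ℕ, (2 : ℝ≥0∞) ^ (-((i₀ + n : ℤ) : ℝ) * s) *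
      (2 * (4 * (η ^ p / 4 / ENNReal.ofReal (φ (2 ^ (-(i₀ + n)))))) ^ (1 / p)) =
      (2 * η) * ((2 : ℝ≥0∞) ^ (-((i₀ + n : ℤ) : ℝ) * s) *
      ENNReal.ofReal (φ (2 ^ (-(i₀ + n)))) ^ (-(1 / p))) := by
    intro n
    rw [← mul_div_assoc, ENNReal.mul_div_cancel (by simp) (by simp),
      ENNReal.div_rpow_of_nonneg _ _ (by positivity), ← ENNReal.rpow_mul,
      mul_one_div_cancel hp.ne', ENNReal.rpow_one, div_eq_mul_inv, ← ENNReal.rpow_neg]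
    ring
  simp_rw [hterm]
  rw [ENNReal.tsum_mul_left, ← hS_def]
  calc 2 * η * S ≤ 2 * η * (S + 1) := by gcongr; simp
    _ = 2⁻¹ * (η * (4 * (S + 1))) := by
      have : (2 : ℝ≥0∞) = 2⁻¹ * 4 := by
        rw [show (4 : ℝ≥0∞) = 2 * 2 by norm_num, ← mul_assoc,
          ENNReal.inv_mul_cancel (by simp) (by simp), one_mul]
      nth_rw 1 [this]
      ring
    _ = 2⁻¹ := by
      rw [hη, ENNReal.inv_mul_cancel (by simp) (ENNReal.mul_ne_top (by simp) (by simpa)), mul_one]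

/-! ### Tail gradients -/

/-- The `p`-th power of a gradient of `u` controlling its oscillation at all scales below `2^{-i}`. -/
def tailGradient (s p : ℝ) (g : ℤ → X → ℝ≥0∞) (i : ℤ) (y : X) : ℝ≥0∞ :=
  ∑' m : ℕ, ((2 : ℝ≥0∞) ^ (-(s * p))) ^ m * g (i + m) y ^ p

lemma aemeasurable_tailGradient [MeasurableSpace X] {μ : Measure X} (s p : ℝ) {g : ℤ → X → ℝ≥0∞}
    (hg : ∀ k, AEMeasurable (g k) μ) (i : ℤ) : AEMeasurable (tailGradient s p g i) μ :=
  AEMeasurable.tsum fun _ => ((hg _).pow_const p).const_mul _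

lemma lintegral_tailGradient [MeasurableSpace X] {μ : Measure X} (s : ℝ) {p : ℝ} (hp : 0 < p)
    {g : ℤ → X → ℝ≥0∞}
    (hg : ∀ k, AEMeasurable (g k) μ) (i : ℤ) :
    ∫⁻ y, tailGradient s p g i y ∂μ =
      ∑' m : ℕ, ((2 : ℝ≥0∞) ^ (-(s * p))) ^ m *
        eLpNorm (g (i + m)) (ENNReal.ofReal p) μ ^ p := by
  unfold tailGradient
  rw [lintegral_tsum fun _ => ((hg _).pow_const p).const_mul _]
  refine tsum_congr fun m => ?_
  rw [lintegral_const_mul'' _ ((hg _).pow_const p),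
    eLpNorm_eq_lintegral_rpow_enorm_toReal (by simpa using hp) ENNReal.ofReal_ne_top,
    ENNReal.toReal_ofReal hp.le, ← ENNReal.rpow_mul, one_div_mul_cancel hp.ne', ENNReal.rpow_one]
  simp

lemma mul_le_tailGradient_rpow {s p : ℝ} (hp : 0 < p) (g : ℤ → X → ℝ≥0∞) (i : ℤ) (m : ℕ) (y : X) :
    (2 : ℝ≥0∞) ^ (-((i + m : ℤ) : ℝ) * s) * g (i + m) y ≤
      (2 : ℝ≥0∞) ^ (-(i : ℝ) * s) * tailGradient s p g i y ^ (1 / p) := by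
  have h : ((2 : ℝ≥0∞) ^ (-(s * p))) ^ m * g (i + m) y ^ p ≤ tailGradient s p g i y :=
    ENNReal.le_tsum (f := fun m : ℕ => ((2 : ℝ≥0∞) ^ (-(s * p))) ^ m * g (i + m) y ^ p) m
  have h' := ENNReal.rpow_le_rpow h (z := 1 / p) (by positivity)
  rw [ENNReal.mul_rpow_of_nonneg _ _ (by positivity), ← ENNReal.rpow_mul, mul_one_div_cancel hp.ne',
    ENNReal.rpow_one, ← ENNReal.rpow_natCast, ← ENNReal.rpow_mul, ← ENNReal.rpow_mul] at h'
  refine le_trans (le_of_eq ?_) (mul_le_mul_right h' _)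
  rw [← mul_assoc, ← ENNReal.rpow_add _ _ (by simp) (by simp)]
  congr 2
  push_cast
  field_simp
  ring

/-- The pair `x ≠ y` lies in a single dyadic shell, of index `i + m` with `m ≥ 0`, so only `g_{i+m}`
enters, and it is dominated by one term of the tail series. -/
lemma edist_le_tailGradient [MetricSpace X] {s p : ℝ} (hs : 0 < s) (hp : 0 < p) {u : X → EReal}
    {g : ℤ → X → ℝ≥0∞} {N : Set X}
    (hN : ∀ (k : ℤ) (x y : X), x ∉ N → y ∉ N →
      (2 : ℝ) ^ (-k - 1) ≤ dist x y → dist x y < (2 : ℝ) ^ (-k) →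
        (u x - u y).abs ≤ ENNReal.ofReal (dist x y ^ s) * (g k x + g k y))
    {x y : X} (hx : x ∉ N) (hy : y ∉ N) (hux : u x ≠ ⊤ ∧ u x ≠ ⊥) (huy : u y ≠ ⊤ ∧ u y ≠ ⊥)
    {i : ℤ} (hxy : dist x y < 2 ^ (-i)) :
    edist (u x).toReal (u y).toReal ≤ (2 : ℝ≥0∞) ^ (-(i : ℝ) * s) *
      (tailGradient s p g i x ^ (1 / p) + tailGradient s p g i y ^ (1 / p)) := by
  rcases eq_or_ne x y with rfl | hne
  · simp
  obtain ⟨n, hn1, hn2⟩ := exists_mem_Ico_zpow (dist_pos.2 hne) (one_lt_two (α := ℝ))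
  have hni : n < -i := (zpow_lt_zpow_iff_right₀ (one_lt_two (α := ℝ))).1 (hn1.trans_lt hxy)
  obtain ⟨m, hm⟩ := Int.eq_ofNat_of_zero_le (show 0 ≤ -n - 1 - i by omega)
  have hj : -(i + (m : ℤ)) = n + 1 := by omega
  have key := hN (i + m) x y hx hy (by rw [hj, add_sub_cancel_right]; exact hn1)
    (by rw [hj]; exact hn2)
  have habs : (u x - u y).abs = edist (u x).toReal (u y).toReal := by
    rw [edist_dist, Real.dist_eq, ← EReal.abs_def, EReal.coe_sub, EReal.coe_toReal hux.1 hux.2,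
      EReal.coe_toReal huy.1 huy.2]
  have hd : ENNReal.ofReal (dist x y ^ s) ≤ (2 : ℝ≥0∞) ^ (-((i + m : ℤ) : ℝ) * s) := by
    rw [show (2 : ℝ≥0∞) = ENNReal.ofReal 2 by simp, ENNReal.ofReal_rpow_of_pos two_pos]
    refine ENNReal.ofReal_le_ofReal ?_
    rw [Real.rpow_mul two_pos.le, ← Int.cast_neg, Real.rpow_intCast, hj]
    exact Real.rpow_le_rpow dist_nonneg hn2.le hs.le
  rw [← habs]
  refine key.trans ((mul_le_mul_left hd _).trans ?_)
  rw [mul_add, mul_add]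
  exact add_le_add (mul_le_tailGradient_rpow hp g i m x) (mul_le_tailGradient_rpow hp g i m y)

/-! ### The chain argument -/

lemma four_mul_measure_le_of_lintegral_le [MetricSpace X] [MeasurableSpace X]
    [OpensMeasurableSpace X] {μ : Measure X}
    {F : X → ℝ≥0∞} (hF : AEMeasurable F μ) {x : X} {r : ℝ} {e M : ℝ≥0∞} (he0 : e ≠ 0) (het : e ≠ ∞)
    (h : ∫⁻ y in Metric.ball x r, F y ∂μ ≤ e * M) :
    4 * μ ({y | 4 * e ≤ F y} ∩ Metric.ball x r) ≤ M := by
  have h1 := mul_meas_ge_le_lintegral₀ (hF.restrict (s := Metric.ball x r)) (4 * e)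
  rw [Measure.restrict_apply' Metric.isOpen_ball.measurableSet] at h1
  have h2 := h1.trans h
  rwa [mul_assoc, mul_left_comm, ENNReal.mul_le_mul_iff_right he0 het] at h2

/-- Two quarters and a null set cannot exhaust a ball of positive finite measure; this selects the
points of the chain. -/
lemma exists_mem_of_measure_le [MeasurableSpace X] {μ : Measure X} {B A₁ A₂ A₃ : Set X}
    (hB : 0 < μ B)
    (hB' : μ B < ∞) (h₁ : 4 * μ (A₁ ∩ B) ≤ μ B) (h₂ : 4 * μ (A₂ ∩ B) ≤ μ B) (h₃ : μ A₃ = 0) :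
    ∃ y ∈ B, y ∉ A₁ ∧ y ∉ A₂ ∧ y ∉ A₃ := by
  by_contra! hcon
  have hsub : B ⊆ (A₁ ∩ B) ∪ (A₂ ∩ B) ∪ A₃ := by
    intro y hy
    by_cases h1 : y ∈ A₁
    · exact Or.inl (Or.inl ⟨h1, hy⟩)
    by_cases h2 : y ∈ A₂
    · exact Or.inl (Or.inr ⟨h2, hy⟩)
    · exact Or.inr (hcon y hy h1 h2)
  have hle : μ B ≤ μ (A₁ ∩ B) + μ (A₂ ∩ B) := by
    refine (measure_mono hsub).trans ((measure_union_le _ _).trans ?_)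
    rw [h₃, add_zero]
    exact measure_union_le _ _
  have h4 : 4 * μ B ≤ 2 * μ B := by
    calc 4 * μ B ≤ 4 * (μ (A₁ ∩ B) + μ (A₂ ∩ B)) := by gcongr
      _ ≤ μ B + μ B := by rw [mul_add]; exact add_le_add h₁ h₂
      _ = 2 * μ B := (two_mul _).symm
  rw [ENNReal.mul_le_mul_iff_left hB.ne' hB'.ne] at h4
  norm_num at h4

/-- If a function is small on most of a ball and at least `1` near its centre, then some tail
gradient must be large in mean on a concentric dyadic ball. -/
lemma exists_level_lt_lintegral [MetricSpace X] [MeasurableSpace X] [OpensMeasurableSpace X]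
    {μ : Measure X}
    (hμ : ∀ (x : X) (r : ℝ), 0 < r → 0 < μ (Metric.ball x r) ∧ μ (Metric.ball x r) < ∞)
    {s p : ℝ} (hp : 0 < p) {v : X → ℝ} {F : ℤ → X → ℝ≥0∞} (hF : ∀ i, AEMeasurable (F i) μ)
    {N : Set X} (hN : μ N = 0)
    (hosc : ∀ (i : ℤ) (x y : X), x ∉ N → y ∉ N → dist x y < 2 ^ (-i) →
      edist (v x) (v y) ≤ (2 : ℝ≥0∞) ^ (-(i : ℝ) * s) * (F i x ^ (1 / p) + F i y ^ (1 / p)))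
    {e : ℤ → ℝ≥0∞} (he0 : ∀ i, e i ≠ 0) (het : ∀ i, e i ≠ ∞) {i₀ : ℤ}
    (hsum : ∑' n : ℕ, (2 : ℝ≥0∞) ^ (-((i₀ + n : ℤ) : ℝ) * s) *
      (2 * (4 * e (i₀ + n)) ^ (1 / p)) ≤ 2⁻¹)
    {x : X} {δ : ℝ} (hδ : 0 < δ) (hv : ∀ y ∈ Metric.ball x δ, y ∉ N → 1 ≤ v y)
    {A : Set X} (hA : 4 * μ A ≤ μ (Metric.ball x (2 ^ (-i₀ - 1))))
    (hvA : ∀ y, y ∉ A → y ∉ N → v y < 1 / 2) :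
    ∃ n : ℕ, e (i₀ + n) * μ (Metric.ball x (2 ^ (-(i₀ + n) - 2))) <
      ∫⁻ y in Metric.ball x (2 ^ (-(i₀ + n) - 1)), F (i₀ + n) y ∂μ := by
  by_contra! hcon
  have hpow : ∀ n : ℕ, (2 : ℝ) ^ (-(i₀ + ((n + 1 : ℕ) : ℤ)) - 1) = 2 ^ (-(i₀ + n) - 2) := by
    intro n
    congr 1
    push_cast
    ring
  have hmono : ∀ n : ℕ, Metric.ball x ((2 : ℝ) ^ (-(i₀ + n) - 2)) ⊆
      Metric.ball x (2 ^ (-(i₀ + n) - 1)) := fun n =>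
    Metric.ball_subset_ball (zpow_le_zpow_right₀ one_le_two (by omega))
  -- The bad set of level `n` is at most a quarter of the next smaller ball, so it can be avoided by
  -- the point of level `n + 1` as well, without using doubling.
  have hbad : ∀ n : ℕ, 4 * μ ({y | 4 * e (i₀ + n) ≤ F (i₀ + n) y} ∩
      Metric.ball x (2 ^ (-(i₀ + n) - 1))) ≤ μ (Metric.ball x (2 ^ (-(i₀ + n) - 2))) := fun n =>
    four_mul_measure_le_of_lintegral_le (hF _) (he0 _) (het _) (hcon n)
  have hpos : ∀ n : ℕ, 0 < μ (Metric.ball x (2 ^ (-(i₀ + n) - 1))) ∧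
      μ (Metric.ball x (2 ^ (-(i₀ + n) - 1))) < ∞ := fun n => hμ _ _ (zpow_pos two_pos _)
  -- Each point is good for its own level and the preceding one, so consecutive points share a level
  -- at which both tail gradients are small. At `n = 0` the set `A` replaces the preceding level.
  have hpt : ∀ n : ℕ, ∃ y ∈ Metric.ball x (2 ^ (-(i₀ + n) - 1)), y ∉ N ∧
      F (i₀ + n) y ≤ 4 * e (i₀ + n) ∧ (n = 0 → v y < 1 / 2) ∧
      (∀ k, n = k + 1 → F (i₀ + k) y ≤ 4 * e (i₀ + k)) := by
    rintro (_ | n)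
    · have hA' : 4 * μ (A ∩ Metric.ball x (2 ^ (-(i₀ + ((0 : ℕ) : ℤ)) - 1))) ≤
          μ (Metric.ball x (2 ^ (-(i₀ + ((0 : ℕ) : ℤ)) - 1))) := by
        refine (mul_le_mul_right (measure_mono inter_subset_left) _).trans (hA.trans ?_)
        simp
      obtain ⟨y, hyB, hy1, hy2, hy3⟩ := exists_mem_of_measure_le (hpos 0).1 (hpos 0).2
        ((hbad 0).trans (measure_mono (hmono 0))) hA' hN
      exact ⟨y, hyB, hy3, (not_le.1 hy1).le, fun _ => hvA y hy2 hy3, fun k hk => by omega⟩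
    · have hn : 4 * μ ({y | 4 * e (i₀ + n) ≤ F (i₀ + n) y} ∩
          Metric.ball x (2 ^ (-(i₀ + ((n + 1 : ℕ) : ℤ)) - 1))) ≤
          μ (Metric.ball x (2 ^ (-(i₀ + ((n + 1 : ℕ) : ℤ)) - 1))) := by
        rw [hpow]
        exact (mul_le_mul_right (measure_mono (inter_subset_inter_right _ (hmono n))) _).trans
          (hbad n)
      obtain ⟨y, hyB, hy1, hy2, hy3⟩ := exists_mem_of_measure_le (hpos (n + 1)).1 (hpos (n + 1)).2
        ((hbad (n + 1)).trans (measure_mono (hmono (n + 1)))) hn hN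
      refine ⟨y, hyB, hy3, (not_le.1 hy1).le, fun h => by omega, fun k hk => ?_⟩
      obtain rfl : n = k := by omega
      exact (not_le.1 hy2).le
  choose y hyB hyN hyF hy0 hyF' using hpt
  have hstep : ∀ n : ℕ, edist (v (y n)) (v (y (n + 1))) ≤
      (2 : ℝ≥0∞) ^ (-((i₀ + n : ℤ) : ℝ) * s) * (2 * (4 * e (i₀ + n)) ^ (1 / p)) := by
    intro n
    have hd : dist (y n) (y (n + 1)) < 2 ^ (-(i₀ + (n : ℤ))) := by
      have h1 := Metric.mem_ball.1 (hyB n)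
      have h2 := Metric.mem_ball.1 (hmono n (hpow n ▸ hyB (n + 1)))
      have h3 : (2 : ℝ) ^ (-(i₀ + (n : ℤ)) - 1) = 2 ^ (-(i₀ + (n : ℤ))) / 2 := by
        rw [zpow_sub_one₀ two_ne_zero, div_eq_mul_inv]
      have h4 := dist_triangle_right (y n) (y (n + 1)) x
      linarith
    refine (hosc _ _ _ (hyN n) (hyN (n + 1)) hd).trans (mul_le_mul_right ?_ _)
    rw [two_mul]
    exact add_le_add (ENNReal.rpow_le_rpow (hyF n) (by positivity))
      (ENNReal.rpow_le_rpow (hyF' (n + 1) n rfl) (by positivity))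
  -- Once the radius is below `δ`, the chain has reached `v ≥ 1` from `v < 1/2` with total variation
  -- at most `1/2`, a contradiction.
  have htend : Filter.Tendsto (fun n : ℕ => (2 : ℝ) ^ (-(i₀ + (n : ℤ)) - 1)) Filter.atTop
      (nhds 0) := by
    have h := (tendsto_pow_atTop_nhds_zero_of_lt_one (r := (1 / 2 : ℝ)) (by norm_num)
      (by norm_num)).const_mul ((2 : ℝ) ^ (-i₀ - 1))
    rw [mul_zero] at h
    refine h.congr fun n => ?_
    rw [show -(i₀ + (n : ℤ)) - 1 = (-i₀ - 1) + -(n : ℤ) by ring, zpow_add₀ two_ne_zero,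
      zpow_neg _ (n : ℤ), zpow_natCast, one_div, inv_pow]
  obtain ⟨n, hn⟩ := (htend.eventually (gt_mem_nhds hδ)).exists
  have h1 : 1 ≤ v (y n) := hv _ (Metric.ball_subset_ball hn.le (hyB n)) (hyN n)
  have h2 : edist (v (y 0)) (v (y n)) ≤ 2⁻¹ :=
    (edist_le_range_sum_edist (fun k => v (y k)) n).trans <|
      (Finset.sum_le_sum fun k _ => hstep k).trans <| (ENNReal.sum_le_tsum _).trans hsum
  have h3 := hy0 0 rfl
  rw [edist_dist, show (2⁻¹ : ℝ≥0∞) = ENNReal.ofReal 2⁻¹ by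
    rw [ENNReal.ofReal_inv_of_pos two_pos]; simp, ENNReal.ofReal_le_ofReal_iff (by norm_num),
    Real.dist_eq, abs_le] at h2
  linarith [h2.1]

/-! ### Covering the points of one bad scale -/

/-- A Vitali covering at a single scale. -/
lemma exists_ball_cover [MetricSpace X] [MeasurableSpace X] [OpensMeasurableSpace X]
    {μ : Measure X} {cd : ℝ≥0}
    (hcd : ∀ (x : X) (r : ℝ), 0 < r → μ (Metric.ball x (2 * r)) ≤ cd * μ (Metric.ball x r))
    {F : X → ℝ≥0∞} {e : ℝ≥0∞} {r : ℝ} (hr : 0 < r) {E : Set X} (hE : TotallyBounded E)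
    (hbad : ∀ x ∈ E, e * μ (Metric.ball x (r / 4)) ≤ ∫⁻ y in Metric.ball x (r / 2), F y ∂μ) :
    ∃ T : Set X, T.Countable ∧ E ⊆ ⋃ x ∈ T, Metric.ball x r ∧
      ∑' x : T, e * μ (Metric.ball x r) ≤ cd ^ 2 * ∫⁻ y, F y ∂μ := by
  obtain ⟨T, hTE, hdisj, hcov⟩ := Vitali.exists_disjoint_subfamily_covering_enlargement
    (fun x : X => Metric.ball x (r / 2)) E (fun _ => (1 : ℝ)) 2 one_lt_two (fun _ _ => zero_le_one)
    1 (fun _ _ => le_rfl) (fun x _ => ⟨x, Metric.mem_ball_self (by positivity)⟩)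
  -- Sending each centre to a point of a finite `r/2`-net is injective, since a common net point
  -- would lie in two disjoint balls.
  have hcount : T.Countable := by
    obtain ⟨t, ht, hEt⟩ := Metric.totallyBounded_iff.1 hE (r / 2) (by positivity)
    have hch : ∀ x : X, ∃ y, x ∈ T → y ∈ t ∧ x ∈ Metric.ball y (r / 2) := by
      intro x
      by_cases hx : x ∈ T
      · obtain ⟨y, hy, hxy⟩ := mem_iUnion₂.1 (hEt (hTE hx))
        exact ⟨y, fun _ => ⟨hy, hxy⟩⟩
      · exact ⟨x, fun h => absurd h hx⟩
    choose f hf using hch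
    refine (Set.Finite.of_finite_image (f := f) (ht.subset ?_) ?_).countable
    · rintro _ ⟨x, hx, rfl⟩
      exact (hf x hx).1
    intro x hx x' hx' hxx'
    by_contra hne
    have hd := Set.disjoint_left.1 (hdisj hx hx' hne)
    refine hd (a := f x) ?_ ?_
    · simpa [dist_comm] using (hf x hx).2
    · rw [hxx']
      simpa [dist_comm] using (hf x' hx').2
  refine ⟨T, hcount, fun x hx => ?_, ?_⟩
  · obtain ⟨y, hy, ⟨z, hzx, hzy⟩, -⟩ := hcov x hx
    refine mem_iUnion₂.2 ⟨y, hy, ?_⟩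
    rw [Metric.mem_ball] at *
    have := dist_triangle_left x y z
    linarith
  · have hle : ∀ x : T, e * μ (Metric.ball x r) ≤
        cd ^ 2 * ∫⁻ y in Metric.ball (x : X) (r / 2), F y ∂μ := by
      intro x
      -- Doubling twice, from `r/4` to `r`, produces `cd ^ 2`.
      have h1 := hcd x (r / 2) (by positivity)
      have h2 := hcd x (r / 4) (by positivity)
      rw [show 2 * (r / 2) = r by ring] at h1
      rw [show 2 * (r / 4) = r / 2 by ring] at h2
      calc e * μ (Metric.ball x r) ≤ e * (cd * (cd * μ (Metric.ball x (r / 4)))) := by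
            gcongr
            exact h1.trans (by gcongr)
        _ = cd ^ 2 * (e * μ (Metric.ball x (r / 4))) := by ring
        _ ≤ _ := by gcongr; exact hbad x (hTE x.2)
    refine (ENNReal.tsum_le_tsum hle).trans ?_
    rw [ENNReal.tsum_mul_left]
    gcongr
    rw [← lintegral_biUnion hcount (fun _ _ => Metric.isOpen_ball.measurableSet) hdisj]
    exact setLIntegral_le_lintegral _ _

/-! ### The estimate for functions with small norm -/

lemma measurable_ereal_abs : Measurable EReal.abs := by
  have h : EReal.abs = fun x : EReal => max x.toENNReal (-x).toENNReal := by
    funext x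
    induction x with
    | bot => simp
    | top => simp
    | coe r =>
      rw [EReal.abs_def, ← EReal.coe_neg, EReal.toENNReal_of_ne_top (EReal.coe_ne_top _),
        EReal.toENNReal_of_ne_top (EReal.coe_ne_top _), EReal.toReal_coe, EReal.toReal_coe,
        abs_eq_max_neg, ENNReal.ofReal_max]
  rw [h]
  exact measurable_ereal_toENNReal.max (measurable_ereal_toENNReal.comp measurable_neg)

lemma measure_half_le_abs_le [MeasurableSpace X] {μ : Measure X} {p : ℝ} (hp : 0 < p)
    {u : X → EReal}
    (hu : AEMeasurable u μ) :
    (2⁻¹ : ℝ≥0∞) ^ p * μ {y | 2⁻¹ ≤ (u y).abs} ≤ extLpNorm μ p u ^ p := by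
  have h := mul_meas_ge_le_pow_eLpNorm' μ (p := ENNReal.ofReal p) (by simpa using hp)
    ENNReal.ofReal_ne_top (f := fun x => (u x).abs)
    (measurable_ereal_abs.comp_aemeasurable hu).aestronglyMeasurable 2⁻¹
  simpa [ENNReal.toReal_ofReal hp.le, extLpNorm] using h

/-- The estimate of the cocontent by a gradient of a function with small `L^p` norm. -/
lemma cocontent_le_of_small [MetricSpace X] [MeasurableSpace X] [BorelSpace X] [Nonempty X]
    {μ : Measure X}
    (hμ : ∀ (x : X) (r : ℝ), 0 < r → 0 < μ (Metric.ball x r) ∧ μ (Metric.ball x r) < ∞)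
    {cd : ℝ≥0}
    (hcd : ∀ (x : X) (r : ℝ), 0 < r → μ (Metric.ball x (2 * r)) ≤ cd * μ (Metric.ball x r))
    {s p : ℝ} {q : ℝ≥0∞} (hs0 : 0 < s) (hp : 0 < p) (hq : 0 < q) {φ : ℝ → ℝ}
    (hφpos : ∀ t, 0 < t → 0 < φ t) {i₀ : ℤ} {ε : ℝ≥0∞} (hε0 : ε ≠ 0) (hεt : ε ≠ ∞)
    (hε : ∑' n : ℕ, (2 : ℝ≥0∞) ^ (-((i₀ + n : ℤ) : ℝ) * s) *
      (2 * (4 * (ε / ENNReal.ofReal (φ (2 ^ (-(i₀ + n)))))) ^ (1 / p)) ≤ 2⁻¹)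
    {K : ℝ≥0∞} (hK : ∀ a : ℤ → ℝ≥0∞, lqNorm (q / ENNReal.ofReal p)
      (fun i => ∑' m : ℕ, ((2 : ℝ≥0∞) ^ (-(s * p))) ^ m * a (i + m)) ≤
      K * lqNorm (q / ENNReal.ofReal p) a)
    {E : Set X} (hE : IsCompact E) {u : X → EReal} (hu : MemL0 μ u)
    {U : Set X} (hU : IsOpen U) (hEU : E ⊆ U) (hU1 : ∀ x ∈ U, 1 ≤ u x)
    (hsmall : ∀ x ∈ E, 4 * μ {y | 2⁻¹ ≤ (u y).abs} ≤ μ (Metric.ball x (2 ^ (-i₀ - 1))))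
    {g : ℤ → X → ℝ≥0∞} (hg : IsFracGradient μ s u g) :
    cocontent μ φ (q / ENNReal.ofReal p) (2 ^ (-i₀)) E ≤
      ε⁻¹ * cd ^ 2 * K * lqLpNorm μ p q g ^ p := by
  obtain ⟨hgm, N₀, hN₀, hN⟩ := hg
  -- Adding the points of infinite value to the null set makes `toReal` faithful off `N`.
  set N : Set X := N₀ ∪ {y | ¬(u y ≠ ⊤ ∧ u y ≠ ⊥)} with hN_def
  have hNnull : μ N = 0 := measure_union_null hN₀ hu.2
  have hufin : ∀ {y}, y ∉ N → u y ≠ ⊤ ∧ u y ≠ ⊥ := fun {y} hy => by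
    by_contra h
    exact hy (Or.inr h)
  have hucoe : ∀ {y}, y ∉ N → ((u y).toReal : EReal) = u y := fun hy =>
    EReal.coe_toReal (hufin hy).1 (hufin hy).2
  set F := tailGradient s p g
  set e : ℤ → ℝ≥0∞ := fun i => ε / ENNReal.ofReal (φ (2 ^ (-i))) with he
  have hφ0 : ∀ i : ℤ, ENNReal.ofReal (φ (2 ^ (-i))) ≠ 0 := fun i =>
    (ENNReal.ofReal_pos.2 (hφpos _ (zpow_pos two_pos _))).ne'
  have hlevel : ∀ x ∈ E, ∃ n : ℕ, e (i₀ + n) * μ (Metric.ball x (2 ^ (-(i₀ + n) - 2))) <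
      ∫⁻ y in Metric.ball x (2 ^ (-(i₀ + n) - 1)), F (i₀ + n) y ∂μ := by
    intro x hx
    obtain ⟨δ, hδ, hδU⟩ := Metric.isOpen_iff.1 hU x (hEU hx)
    refine exists_level_lt_lintegral hμ hp (v := fun y => (u y).toReal)
      (fun i => aemeasurable_tailGradient s p hgm i) hNnull
      (fun i y z hy hz hyz => edist_le_tailGradient hs0 hp hN (fun h => hy (Or.inl h))
        (fun h => hz (Or.inl h)) (hufin hy) (hufin hz) hyz)
      (fun i => ENNReal.div_ne_zero.2 ⟨hε0, ENNReal.ofReal_ne_top⟩)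
      (fun i => ENNReal.div_ne_top hεt (hφ0 i)) hε hδ ?_ (hsmall x hx) ?_
    · intro y hy hyN
      have h := hU1 y (hδU hy)
      rw [← hucoe hyN] at h
      exact_mod_cast h
    · intro y hyA hyN
      have h : (u y).abs < 2⁻¹ := not_le.1 hyA
      rw [← hucoe hyN, EReal.abs_def, show (2⁻¹ : ℝ≥0∞) = ENNReal.ofReal (1 / 2) by
        rw [one_div, ENNReal.ofReal_inv_of_pos two_pos]; simp,
        ENNReal.ofReal_lt_ofReal_iff (by norm_num)] at h
      exact (le_abs_self _).trans_lt h
  have hr : ∀ i : ℤ, (0 : ℝ) < 2 ^ (-i) := fun i => zpow_pos two_pos _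
  have hr2 : ∀ i : ℤ, (2 : ℝ) ^ (-i - 1) = 2 ^ (-i) / 2 := fun i => by
    rw [zpow_sub_one₀ two_ne_zero, div_eq_mul_inv]
  have hr4 : ∀ i : ℤ, (2 : ℝ) ^ (-i - 2) = 2 ^ (-i) / 4 := fun i => by
    rw [zpow_sub₀ two_ne_zero]
    norm_num
  have hcover : ∀ n : ℕ, ∃ T : Set X, T.Countable ∧
      {x ∈ E | e (i₀ + n) * μ (Metric.ball x (2 ^ (-(i₀ + n) - 2))) <
        ∫⁻ y in Metric.ball x (2 ^ (-(i₀ + n) - 1)), F (i₀ + n) y ∂μ} ⊆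
        ⋃ x ∈ T, Metric.ball x (2 ^ (-(i₀ + (n : ℤ)))) ∧
      ∑' x : T, e (i₀ + n) * μ (Metric.ball x (2 ^ (-(i₀ + (n : ℤ))))) ≤
        cd ^ 2 * ∫⁻ y, F (i₀ + n) y ∂μ := fun n =>
    exists_ball_cover hcd (hr _) (hE.totallyBounded.subset fun _ h => h.1) fun x hx => by
      have h := hx.2.le
      rwa [hr2, hr4] at h
  choose T hTc hTE hTsum using hcover
  have : ∀ n, Countable (T n) := fun n => (hTc n).to_subtype
  refine (cocontent_le_of_countable μ φ _ _ E (ι := Σ n : ℕ, T n) (fun a => (a.2 : X))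
    (fun a => 2 ^ (-(i₀ + (a.1 : ℤ)))) (fun a => ⟨hr _, zpow_le_zpow_right₀ one_le_two (by omega)⟩)
    fun x hx => ?_).trans ?_
  · obtain ⟨n, hn⟩ := hlevel x hx
    obtain ⟨y, hy, hxy⟩ := mem_iUnion₂.1 (hTE n ⟨hx, hn⟩)
    exact mem_iUnion.2 ⟨⟨n, y, hy⟩, hxy⟩
  have hθ : 0 < q / ENNReal.ofReal p := ENNReal.div_pos hq.ne' ENNReal.ofReal_ne_top
  have hlev : ∀ i : ℤ, (∑' a : {a : Σ n : ℕ, T n // (2 : ℝ) ^ (-i) ≤ 2 ^ (-(i₀ + (a.1 : ℤ))) ∧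
      (2 : ℝ) ^ (-(i₀ + (a.1 : ℤ))) < 2 ^ (-i + 1)},
        μ (Metric.ball (a.1.2 : X) (2 ^ (-(i₀ + (a.1.1 : ℤ))))) /
          ENNReal.ofReal (φ (2 ^ (-(i₀ + (a.1.1 : ℤ)))))) ≤
      (ε⁻¹ * cd ^ 2) * ∑' m : ℕ, ((2 : ℝ≥0∞) ^ (-(s * p))) ^ m *
        eLpNorm (g (i + m)) (ENNReal.ofReal p) μ ^ p := by
    intro i
    -- All radii are exact powers of two, so level `i` receives only the balls from the stage `n = i
    -- - i₀`.
    have hidx : ∀ n : ℕ, (2 : ℝ) ^ (-i) ≤ 2 ^ (-(i₀ + (n : ℤ))) ∧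
        (2 : ℝ) ^ (-(i₀ + (n : ℤ))) < 2 ^ (-i + 1) → i = i₀ + n := by
      rintro n ⟨h1, h2⟩
      have h3 := (zpow_le_zpow_iff_right₀ (one_lt_two (α := ℝ))).1 h1
      have h4 := (zpow_lt_zpow_iff_right₀ (one_lt_two (α := ℝ))).1 h2
      omega
    by_cases hi : ∃ n : ℕ, i = i₀ + n
    · obtain ⟨n, rfl⟩ := hi
      have hmem : ∀ (a : Σ n : ℕ, T n) (n : ℕ), a.1 = n → (a.2 : X) ∈ T n := by
        rintro a _ rfl
        exact a.2.2
      have hn : ∀ a : {a : Σ n : ℕ, T n // (2 : ℝ) ^ (-(i₀ + (n : ℤ))) ≤ 2 ^ (-(i₀ + (a.1 : ℤ))) ∧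
          (2 : ℝ) ^ (-(i₀ + (a.1 : ℤ))) < 2 ^ (-(i₀ + (n : ℤ)) + 1)}, a.1.1 = n := fun a => by
        have := hidx _ a.2
        omega
      let f : {a : Σ n : ℕ, T n // (2 : ℝ) ^ (-(i₀ + (n : ℤ))) ≤ 2 ^ (-(i₀ + (a.1 : ℤ))) ∧
          (2 : ℝ) ^ (-(i₀ + (a.1 : ℤ))) < 2 ^ (-(i₀ + (n : ℤ)) + 1)} → T n :=
        fun a => ⟨a.1.2, hmem _ _ (hn a)⟩
      have hf : Function.Injective f := by
        rintro a b hab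
        have ha := hn a
        have hb := hn b
        obtain ⟨⟨k, x, hx⟩, hk⟩ := a
        obtain ⟨⟨l, y, hy⟩, hl⟩ := b
        dsimp only at ha hb
        subst ha
        subst hb
        obtain rfl : x = y := congrArg Subtype.val hab
        rfl
      rw [← lintegral_tailGradient s hp hgm, mul_assoc]
      refine le_trans ?_ (mul_le_mul_right (hTsum n) _)
      rw [← ENNReal.tsum_mul_left]
      refine le_trans (le_of_eq ?_) (ENNReal.tsum_comp_le_tsum_of_injective hf _)
      refine tsum_congr fun a => ?_
      change _ = ε⁻¹ * (e (i₀ + n) * μ (Metric.ball (a.1.2 : X) _))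
      generalize (a.1.2 : X) = x
      rw [hn a, he]
      rw [← mul_assoc, ← mul_div_assoc, ENNReal.inv_mul_cancel hε0 hεt, one_div, mul_comm,
        div_eq_mul_inv]
    · refine (le_of_eq (ENNReal.tsum_eq_zero.2 fun a => ?_)).trans zero_le
      exact absurd ⟨_, hidx _ a.2⟩ hi
  refine (lqNorm_mono hlev).trans ?_
  rw [lqNorm_const_mul hθ, mul_assoc _ K]
  refine mul_le_mul_right ((hK fun k => eLpNorm (g k) (ENNReal.ofReal p) μ ^ p).trans
    (le_of_eq ?_)) _
  rw [lqNorm_rpow hp hq]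
  rfl

end BesovCap

end

/-! ### The dichotomy on the `L^p` norm -/

theorem mainTheorem2 {X : Type*} [MetricSpace X] [MeasurableSpace X] [BorelSpace X]
    (μ : Measure X) (hμ : BesovCap.IsDoublingMeasure μ)
    (s p : ℝ) (q : ℝ≥0∞) (hs0 : 0 < s) (hs1 : s < 1) (hp : 0 < p) (hq : 0 < q)
    (φ : ℝ → ℝ) (hφpos : ∀ t, 0 < t → 0 < φ t) (hφmono : MonotoneOn φ (Set.Ioi 0))
    (hφint : ∀ a : ℝ, 0 < a →
      IntegrableOn (fun t : ℝ => φ t ^ (-(1 / p)) * t ^ (s - 1)) (Set.Ioo 0 a) volume)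
    (x₀ : X) (R : ℝ) (hR : 0 < R)
    (hne : (Metric.ball x₀ (8 * R) \ Metric.ball x₀ (4 * R)).Nonempty) :
    ∃ C c : ℝ, 0 < C ∧ 0 < c ∧
      ∀ E : Set X, IsCompact E → E ⊆ Metric.ball x₀ R →
        BesovCap.cocontent μ φ (q / ENNReal.ofReal p) (c * R) E
          ≤ ENNReal.ofReal C * BesovCap.besovCapacity μ s p q E := by
  obtain ⟨hμb, cd, hcd⟩ := hμ
  have hθ : 0 < q / ENNReal.ofReal p := ENNReal.div_pos hq.ne' ENNReal.ofReal_ne_top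
  -- Then `B(x₀, R) ⊆ B(x, 2^{-i₀-1})` for every `x ∈ E`, so one smallness threshold serves all of
  -- `E`.
  obtain ⟨i₀, hi₀⟩ : ∃ i₀ : ℤ, 2 * R ≤ 2 ^ (-i₀ - 1) := by
    obtain ⟨n, hn⟩ := pow_unbounded_of_one_lt (2 * R) (one_lt_two (α := ℝ))
    refine ⟨-n - 1, hn.le.trans (le_of_eq ?_)⟩
    rw [← zpow_natCast]
    congr 1
    ring
  obtain ⟨ε, hε0, hεt, hε⟩ := BesovCap.exists_eps hs1 hp hφpos hφmono hφint i₀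
  have hρ : (2 : ℝ≥0∞) ^ (-(s * p)) < 1 :=
    ENNReal.rpow_lt_one_of_one_lt_of_neg (by norm_num) (by have := mul_pos hs0 hp; linarith)
  obtain ⟨K, hKt, hK⟩ := BesovCap.lqNorm_geometric_le hθ hρ
  obtain ⟨hB0, hBt⟩ := hμb x₀ R hR
  set M := μ (Metric.ball x₀ R) with hM
  -- By Chebyshev at height `1/2`, `‖u‖_p^p ≤ δ` forces `μ {|u| ≥ 1/2} ≤ M / 4`.
  set δ : ℝ≥0∞ := (2⁻¹ : ℝ≥0∞) ^ p * (M / 4) with hδ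
  have h2p0 : (2⁻¹ : ℝ≥0∞) ^ p ≠ 0 := (ENNReal.rpow_pos (by simp) (by simp)).ne'
  have h2pt : (2⁻¹ : ℝ≥0∞) ^ p ≠ ∞ := ENNReal.rpow_ne_top_of_nonneg hp.le (by simp)
  have hδ0 : δ ≠ 0 := mul_ne_zero h2p0 (ENNReal.div_ne_zero.2 ⟨hB0.ne', by simp⟩)
  have hδt : δ ≠ ∞ := ENNReal.mul_ne_top h2pt (ENNReal.div_ne_top hBt.ne (by simp))
  have hφR : ENNReal.ofReal (φ R) ≠ 0 := by simpa using hφpos R hR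
  set C₁ : ℝ≥0∞ := M / ENNReal.ofReal (φ R) / δ with hC₁
  set C₂ : ℝ≥0∞ := ε⁻¹ * cd ^ 2 * K with hC₂
  have hC₁t : C₁ ≠ ∞ := ENNReal.div_ne_top (ENNReal.div_ne_top hBt.ne hφR) hδ0
  have hC₂t : C₂ ≠ ∞ := ENNReal.mul_ne_top
    (ENNReal.mul_ne_top (ENNReal.inv_ne_top.2 hε0) (by simp)) hKt
  -- The `+ 1` makes the constant nonzero, so that it can be divided out before passing to the
  -- infimum over `u`.
  have hCt : C₁ + C₂ + 1 ≠ ∞ := by simp [hC₁t, hC₂t]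
  have hcR : 2 ^ (-i₀) / R * R = (2 : ℝ) ^ (-i₀) := div_mul_cancel₀ _ hR.ne'
  have hR₀ : R ≤ 2 ^ (-i₀) := by
    rw [zpow_sub_one₀ two_ne_zero] at hi₀
    linarith [zpow_pos (two_pos (α := ℝ)) (-i₀)]
  refine ⟨(C₁ + C₂ + 1).toReal, 2 ^ (-i₀) / R, ENNReal.toReal_pos (by simp) hCt,
    by positivity, fun E hE hER => ?_⟩
  rw [ENNReal.ofReal_toReal hCt, hcR]
  set H := BesovCap.cocontent μ φ (q / ENNReal.ofReal p) (2 ^ (-i₀)) E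
  have hC0 : C₁ + C₂ + 1 ≠ 0 := by simp
  rw [mul_comm, ← ENNReal.div_le_iff_le_mul (Or.inl hC0) (Or.inl hCt)]
  refine le_iInf₂ fun u hu => ?_
  obtain ⟨⟨hu0, -, -⟩, U, hU, hEU, hU1⟩ := hu
  by_cases hsm : BesovCap.extLpNorm μ p u ^ p ≤ δ
  · have hsmall : ∀ x ∈ E, 4 * μ {y | 2⁻¹ ≤ (u y).abs} ≤ μ (Metric.ball x (2 ^ (-i₀ - 1))) := by
      intro x hx
      have h1 := (BesovCap.measure_half_le_abs_le hp hu0.1).trans hsm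
      rw [hδ, ENNReal.mul_le_mul_iff_right h2p0 h2pt] at h1
      calc 4 * μ {y | 2⁻¹ ≤ (u y).abs} ≤ 4 * (M / 4) := by gcongr
        _ = M := ENNReal.mul_div_cancel (by simp) (by simp)
        _ ≤ _ := by
          refine measure_mono (Metric.ball_subset_ball' ?_)
          have := Metric.mem_ball'.1 (hER hx)
          linarith
    have : Nonempty X := ⟨x₀⟩
    have hhom : H / (C₁ + C₂ + 1) ≤ BesovCap.homBesovNorm μ s p q u ^ p := by
      -- The infimum over gradients sits inside the `p`-th power, so a root is taken to reach it.
      rw [← ENNReal.rpow_le_rpow_iff (z := p⁻¹) (by positivity), ENNReal.rpow_rpow_inv hp.ne']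
      refine le_iInf₂ fun g hg => ?_
      rw [ENNReal.rpow_inv_le_iff hp, ENNReal.div_le_iff_le_mul (Or.inl hC0) (Or.inl hCt), mul_comm]
      refine (BesovCap.cocontent_le_of_small hμb hcd hs0 hp hq hφpos hε0 hεt hε hK hE hu0 hU hEU hU1
        hsmall hg).trans (mul_le_mul_left ?_ _)
      exact le_add_self.trans le_self_add
    exact hhom.trans (ENNReal.rpow_le_rpow le_add_self hp.le)
  · rw [ENNReal.div_le_iff_le_mul (Or.inl hC0) (Or.inl hCt), mul_comm]
    calc H ≤ M / ENNReal.ofReal (φ R) := BesovCap.cocontent_le_single μ φ hθ hR hR₀ hER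
      _ = C₁ * δ := (ENNReal.div_mul_cancel hδ0 hδt).symm
      _ ≤ (C₁ + C₂ + 1) * BesovCap.besovNorm μ s p q u ^ p := by
        refine mul_le_mul' (by rw [add_assoc]; exact le_self_add) ?_
        exact (not_le.1 hsm).le.trans (ENNReal.rpow_le_rpow le_self_add hp.le)
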